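/- Let $m$ be a nonnegative integer and let $C \subseteq \mathbb{F}_2^{n}$ be an extremal binary doubly even self-dual code of length $n = 24m$; that is, $C$ is a linear code with $C = C^\perp$ (for the standard inner product), all weights of $C$ are divisible by $4$, and the least weight of a nonzero codeword is $4m+4$. For every integer $w$ with $w \equiv 0 \pmod 4$ and $4m+4 \le w \le n-(4m+4)$, let $D_w$ be the support design of $C$ for the weight $w$: its points are the $n$ coordinate indices, and its blocks are the supports $\{i : c_i \ne 0\}$ of all codewords $c\in C$ of weight $w$. Then either $D_w$ is an $8$-design for every such $w$, or $D_w$ is an $8$-design for no such $w$. (A collection of blocks, all of the same size, is an $8$-design if there is an integer $\lambda \ge 0$ such that any $8$ points are contained in precisely $\lambda$ blocks.) -/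

import Mathlib

/-- The Hamming weight of a binary word of length `n` is Mathlib's `hammingNorm`. This is the support
of a word: the set of indices of its nonzero coordinates. -/
def wordSupport {n : ℕ} (c : Fin n → ZMod 2) : Finset (Fin n) :=
  Finset.univ.filter fun i => c i ≠ 0

/-- The dual code with respect to the standard inner product on `(ZMod 2)^n`. -/
def dualCode {n : ℕ} (C : Submodule (ZMod 2) (Fin n → ZMod 2)) :
    Submodule (ZMod 2) (Fin n → ZMod 2) where
  carrier := {x | ∀ c ∈ C, ∑ i, x i * c i = 0}
  zero_mem' := by
    intro c _
    simp
  add_mem' := by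
    intro x y hx hy c hc
    change ∀ c ∈ C, ∑ i, x i * c i = 0 at hx
    change ∀ c ∈ C, ∑ i, y i * c i = 0 at hy
    simp [add_mul, Finset.sum_add_distrib, hx c hc, hy c hc]
  smul_mem' := by
    intro a x hx c hc
    change ∀ c ∈ C, ∑ i, x i * c i = 0 at hx
    simp [mul_assoc, ← Finset.mul_sum, hx c hc]

/-- A binary linear code is self-dual if it equals its dual code. -/
def IsSelfDualCode {n : ℕ} (C : Submodule (ZMod 2) (Fin n → ZMod 2)) : Prop :=
  dualCode C = C

/-- A binary code is doubly even if all its weights are divisible by `4`. -/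
def IsDoublyEvenCode {n : ℕ} (C : Submodule (ZMod 2) (Fin n → ZMod 2)) : Prop :=
  ∀ c ∈ C, 4 ∣ hammingNorm c

/-- `d` is the minimum weight of `C`: the least weight of a nonzero codeword. -/
def IsMinimumWeight {n : ℕ} (C : Submodule (ZMod 2) (Fin n → ZMod 2)) (d : ℕ) : Prop :=
  IsLeast {w | ∃ c ∈ C, c ≠ 0 ∧ hammingNorm c = w} d

/-- An extremal binary doubly even self-dual code of length `n`: its minimum weight is
`4 * ⌊n / 24⌋ + 4`, where `n / 24` is the division of natural numbers. -/
structure IsExtremalTypeII {n : ℕ} (C : Submodule (ZMod 2) (Fin n → ZMod 2)) : Prop where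
  selfDual : IsSelfDualCode C
  doublyEven : IsDoublyEvenCode C
  minimumWeight : IsMinimumWeight C (4 * (n / 24) + 4)

/-- `𝓑` is the block set of a `t`-`(v, k, l)` design on the point set `X`. -/
structure IsDesign {X : Type*} [Fintype X] (t v k l : ℕ) (𝓑 : Set (Finset X)) : Prop where
  card_points : Fintype.card X = v
  card_block : ∀ B ∈ 𝓑, B.card = k
  card_containing : ∀ T : Finset X, T.card = t → {B | B ∈ 𝓑 ∧ T ⊆ B}.ncard = l

/-- `𝓑` is the block set of a `t`-design on `X`, for some block size and some `l`. -/
def IsTDesign {X : Type*} [Fintype X] (t : ℕ) (𝓑 : Set (Finset X)) : Prop :=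
  ∃ k l : ℕ, IsDesign t (Fintype.card X) k l 𝓑

/-- The blocks of the support design of `C` for the weight `w`: the supports of all codewords of
weight `w`. -/
def supportDesign {n : ℕ} (C : Submodule (ZMod 2) (Fin n → ZMod 2)) (w : ℕ) :
    Set (Finset (Fin n)) :=
  {B | ∃ c ∈ C, hammingNorm c = w ∧ wordSupport c = B}

/-- The weights for which the support design of an extremal binary doubly even self-dual code of
length `n` is considered: `w ≡ 0 (mod 4)` and
`4 * ⌊n / 24⌋ + 4 ≤ w ≤ n - (4 * ⌊n / 24⌋ + 4)`. -/
def IsSupportDesignWeight (n w : ℕ) : Prop :=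
  w ≡ 0 [MOD 4] ∧ 4 * (n / 24) + 4 ≤ w ∧ w + (4 * (n / 24) + 4) ≤ n

/-! Delsarte's criterion: the words of weight `w` form a `t`-design exactly when every product of
differences `c a - c b` over at most `t` (and at least one) disjoint pairs sums to zero over them.
These products are harmonic, so Poisson summation sends the corresponding weighted enumerator to
itself, up to a scalar, under `(x, y) ↦ (x + y, x - y)`.

For `t` pairs and an extremal code the enumerator is `(x * y) ^ (4m+4-t)` times a form of degree `4m
- 2` in `x ^ 4, y ^ 4`, whose coefficients are the sums in question. Invariance makes this form
divisible by `(x ^ 4 - y ^ 4) ^ (4m+4-t)`, leaving a cofactor `q` of degree at most `t - 6` in `x ^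
4, y ^ 4`. So everything vanishes for `t < 6`; `q` is constant for `t = 6`, zero for `t = 7`, and a
multiple of `x ^ 8 + 14 x ^ 4 y ^ 4 + y ^ 8` for `t = 8`. For `q ≠ 0` no coefficient of the
resulting form vanishes, so one zero sum forces all of them to be zero (`coefficients_eq_zero`). -/

namespace ExtremalCode

/-! ### Pair products, monomials and Delsarte's criterion -/

/-- The real number `0` or `1` represented by an element of `ZMod 2`. -/
noncomputable def bit (z : ZMod 2) : ℝ := if z = 0 then 0 else 1

/-- The points of a list of pairs. -/
def points {n : ℕ} (l : List (Fin n × Fin n)) : List (Fin n) :=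
  l.flatMap fun p => [p.1, p.2]

/-- The product over a list of pairs `(a, b)` of the differences `c a - c b`. -/
noncomputable def pairProduct {n : ℕ} (l : List (Fin n × Fin n)) (c : Fin n → ZMod 2) : ℝ :=
  (l.map fun p => bit (c p.1) - bit (c p.2)).prod

/-- The monomial `∏ i ∈ S, c i`. -/
noncomputable def monomialAt {n : ℕ} (S : Finset (Fin n)) (c : Fin n → ZMod 2) : ℝ :=
  ∏ i ∈ S, bit (c i)

/-- The points outside of `S` and of the pairs of `l`. -/
def freePoints {n : ℕ} (l : List (Fin n × Fin n)) (S : Finset (Fin n)) : Finset (Fin n) :=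
  Finset.univ \ (S ∪ (points l).toFinset)

variable {n : ℕ}

theorem bit_zero : bit 0 = 0 := by simp [bit]

theorem bit_one : bit 1 = 1 := by simp [bit]

theorem bit_mul_self (z : ZMod 2) : bit z * bit z = bit z := by
  unfold bit; split_ifs <;> simp

theorem points_cons (a b : Fin n) (l : List (Fin n × Fin n)) :
    points ((a, b) :: l) = a :: b :: points l := by
  simp [points]

theorem length_points (l : List (Fin n × Fin n)) : (points l).length = 2 * l.length := by
  induction l with
  | nil => simp [points]
  | cons p l ih =>
    obtain ⟨a, b⟩ := p
    rw [points_cons]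
    simp only [List.length_cons, ih]
    ring

theorem pairProduct_cons (a b : Fin n) (l : List (Fin n × Fin n)) (c : Fin n → ZMod 2) :
    pairProduct ((a, b) :: l) c = (bit (c a) - bit (c b)) * pairProduct l c := by
  simp [pairProduct]

theorem sum_bit (c : Fin n → ZMod 2) : ∑ i, bit (c i) = hammingNorm c := by
  unfold bit hammingNorm
  rw [Finset.card_filter]
  push_cast
  refine Finset.sum_congr rfl fun i _ => ?_
  split_ifs <;> simp_all

/-- A nonzero pair product means that each pair contains exactly one `1`. -/
theorem pairProduct_mul_sum {l : List (Fin n × Fin n)} (hl : (points l).Nodup)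
    (c : Fin n → ZMod 2) :
    pairProduct l c * ∑ i ∈ (points l).toFinset, bit (c i) = pairProduct l c * l.length := by
  induction l with
  | nil => simp [points]
  | cons p l ih =>
    obtain ⟨a, b⟩ := p
    rw [points_cons] at hl ⊢
    simp only [List.nodup_cons, List.mem_cons, not_or] at hl
    obtain ⟨⟨hab, ha⟩, hb, hl⟩ := hl
    have ih := ih hl
    rw [List.toFinset_cons, List.toFinset_cons, Finset.sum_insert (by simp [hab, ha]),
      Finset.sum_insert (by simp [hb]), pairProduct_cons]
    push_cast [List.length_cons]
    linear_combination (bit (c a) - bit (c b)) * ih +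
      pairProduct l c * (bit_mul_self (c a) - bit_mul_self (c b))

theorem monomialAt_mul_sum (S : Finset (Fin n)) (c : Fin n → ZMod 2) :
    monomialAt S c * ∑ i ∈ S, bit (c i) = monomialAt S c * S.card := by
  rw [Finset.mul_sum]
  have : ∀ i ∈ S, monomialAt S c * bit (c i) = monomialAt S c := by
    intro i hi
    unfold monomialAt
    rw [← Finset.mul_prod_erase S _ hi]
    linear_combination (∏ j ∈ S.erase i, bit (c j)) * bit_mul_self (c i)
  rw [Finset.sum_congr rfl this, Finset.sum_const, nsmul_eq_mul, mul_comm]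

theorem monomialAt_insert {a : Fin n} {S : Finset (Fin n)} (ha : a ∉ S) (c : Fin n → ZMod 2) :
    monomialAt (insert a S) c = bit (c a) * monomialAt S c :=
  Finset.prod_insert ha

theorem mul_sum_freePoints {l : List (Fin n × Fin n)} {S : Finset (Fin n)}
    (hl : (points l).Nodup) (hS : Disjoint S (points l).toFinset) (c : Fin n → ZMod 2) :
    pairProduct l c * monomialAt S c * ∑ i ∈ freePoints l S, bit (c i) =
      ((hammingNorm c : ℝ) - S.card - l.length) * (pairProduct l c * monomialAt S c) := by
  have h := Finset.sum_sdiff (f := fun i => bit (c i))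
    (Finset.subset_univ (S ∪ (points l).toFinset))
  rw [Finset.sum_union hS, sum_bit] at h
  unfold freePoints
  linear_combination pairProduct l c * monomialAt S c * h -
    monomialAt S c * pairProduct_mul_sum hl c - pairProduct l c * monomialAt_mul_sum S c

theorem sum_pairProduct_insert {l : List (Fin n × Fin n)} {S : Finset (Fin n)}
    (hl : (points l).Nodup) (hS : Disjoint S (points l).toFinset)
    {W : Finset (Fin n → ZMod 2)} {w : ℕ} (hW : ∀ c ∈ W, hammingNorm c = w) :
    ∑ b ∈ freePoints l S, ∑ c ∈ W, pairProduct l c * monomialAt (insert b S) c =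
      ((w : ℝ) - S.card - l.length) * ∑ c ∈ W, pairProduct l c * monomialAt S c := by
  rw [Finset.sum_comm, Finset.mul_sum]
  refine Finset.sum_congr rfl fun c hc => ?_
  rw [← hW c hc, ← mul_sum_freePoints hl hS, Finset.mul_sum]
  refine Finset.sum_congr rfl fun b hb => ?_
  rw [monomialAt_insert]
  · ring
  · simp [freePoints] at hb
    tauto

/-- If the sums over `W` do not depend on the free point, they are determined by the sum
without it. -/
theorem card_mul_sum_insert {l : List (Fin n × Fin n)} {S : Finset (Fin n)}
    (hl : (points l).Nodup) (hS : Disjoint S (points l).toFinset)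
    {W : Finset (Fin n → ZMod 2)} {w : ℕ} (hW : ∀ c ∈ W, hammingNorm c = w) {r : ℝ}
    (h : ∀ b ∈ freePoints l S, ∑ c ∈ W, pairProduct l c * monomialAt (insert b S) c = r) :
    ((n : ℝ) - S.card - 2 * l.length) * r =
      ((w : ℝ) - S.card - l.length) * ∑ c ∈ W, pairProduct l c * monomialAt S c := by
  rw [← sum_pairProduct_insert hl hS hW, Finset.sum_congr rfl h, Finset.sum_const, nsmul_eq_mul]
  congr 1
  have h1 := Finset.card_sdiff_add_card_eq_card (Finset.subset_univ (S ∪ (points l).toFinset))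
  rw [Finset.card_union_of_disjoint hS, List.toFinset_card_of_nodup hl, length_points,
    Finset.card_univ, Fintype.card_fin] at h1
  have h2 : (((Finset.univ \ (S ∪ (points l).toFinset)).card : ℝ) +
      (S.card + 2 * l.length)) = n := by exact_mod_cast h1
  unfold freePoints
  linarith

theorem mem_freePoints {l : List (Fin n × Fin n)} {S : Finset (Fin n)} {a : Fin n} :
    a ∈ freePoints l S ↔ a ∉ S ∧ a ∉ points l := by
  simp [freePoints]

/-- Exchanging a point of `S` for a free point changes the sum by one with an extra pair and a
smaller `S`, which vanishes by induction. So the sum does not depend on that point, and averaging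
reduces it to the sum without the point, which also vanishes. -/
theorem sum_pairProduct_monomialAt_eq_zero {t : ℕ}
    {W : Finset (Fin n → ZMod 2)} {w : ℕ} (hW : ∀ c ∈ W, hammingNorm c = w) (ht : 2 * t ≤ n)
    (H : ∀ l : List (Fin n × Fin n), (points l).Nodup → 1 ≤ l.length → l.length ≤ t →
      ∑ c ∈ W, pairProduct l c = 0) (s : ℕ) :
    ∀ (S : Finset (Fin n)) (l : List (Fin n × Fin n)), S.card = s → (points l).Nodup →
      Disjoint S (points l).toFinset → 1 ≤ l.length → l.length + s ≤ t →
      ∑ c ∈ W, pairProduct l c * monomialAt S c = 0 := by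
  induction s with
  | zero =>
    intro S l hS hl _ h1 h2
    rw [Finset.card_eq_zero] at hS
    subst hS
    simpa [monomialAt] using H l hl h1 h2
  | succ s ih =>
    intro S l hS hl hd h1 h2
    obtain ⟨a, S, ha, rfl, hs⟩ := Finset.card_eq_succ.mp hS
    rw [Finset.disjoint_insert_left] at hd
    obtain ⟨hal, hd⟩ := hd
    have key := card_mul_sum_insert (S := S) hl hd hW
      (r := ∑ c ∈ W, pairProduct l c * monomialAt (insert a S) c) (by
        intro b hb
        rw [mem_freePoints] at hb
        by_cases hab : a = b
        · rw [hab]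
        have h0 := ih S ((a, b) :: l) hs (by
            rw [points_cons]
            simp only [List.nodup_cons, List.mem_cons, not_or]
            exact ⟨⟨hab, by simpa using hal⟩, hb.2, hl⟩) (by
            rw [points_cons, List.toFinset_cons, List.toFinset_cons,
              Finset.disjoint_insert_right, Finset.disjoint_insert_right]
            exact ⟨ha, hb.1, hd⟩) (by simp) (by simp only [List.length_cons]; omega)
        rw [eq_comm, ← sub_eq_zero, ← Finset.sum_sub_distrib, ← h0]
        refine Finset.sum_congr rfl fun c _ => ?_
        rw [monomialAt_insert ha, monomialAt_insert hb.1, pairProduct_cons]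
        ring)
    rw [ih S l hs hl hd h1 (by omega), mul_zero] at key
    refine (mul_eq_zero.mp key).resolve_left ?_
    -- Strict because `|l| + |S| < t` and `2 * t ≤ n`.
    have : ((S.card : ℝ) + 2 * l.length) < n := by
      rw [hs]
      exact_mod_cast (by omega : s + 2 * l.length < n)
    linarith

theorem exists_sum_monomialAt_eq {t : ℕ}
    {W : Finset (Fin n → ZMod 2)} {w : ℕ} (hW : ∀ c ∈ W, hammingNorm c = w) (ht : 2 * t ≤ n)
    (H : ∀ l : List (Fin n × Fin n), (points l).Nodup → 1 ≤ l.length → l.length ≤ t →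
      ∑ c ∈ W, pairProduct l c = 0) (s : ℕ) (hs : s ≤ t) :
    ∃ r : ℝ, ∀ S : Finset (Fin n), S.card = s → ∑ c ∈ W, monomialAt S c = r := by
  induction s with
  | zero =>
    refine ⟨∑ c ∈ W, monomialAt ∅ c, fun S hS => ?_⟩
    rw [Finset.card_eq_zero.mp hS]
  | succ s ih =>
    obtain ⟨r, hr⟩ := ih (by omega)
    have hne : ((n : ℝ) - s) ≠ 0 := by
      have : (s : ℝ) < n := by exact_mod_cast (by omega : s < n)
      linarith
    refine ⟨((w : ℝ) - s) * r / (n - s), fun S hS => ?_⟩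
    obtain ⟨a, S, ha, rfl, hs'⟩ := Finset.card_eq_succ.mp hS
    have key := card_mul_sum_insert (S := S) (l := []) (by simp [points]) (by simp [points]) hW
      (r := ∑ c ∈ W, monomialAt (insert a S) c) (by
        intro b hb
        rw [mem_freePoints] at hb
        by_cases hab : a = b
        · simp [hab, pairProduct]
        -- Exchanging `a` for `b` costs the single pair `(a, b)`.
        have h0 := sum_pairProduct_monomialAt_eq_zero hW ht H s S [(a, b)] hs' (by
          simp [points, hab]) (by simp [points, ha, hb.1]) (by simp) (by simp; omega)
        rw [eq_comm, ← sub_eq_zero, ← Finset.sum_sub_distrib, ← h0]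
        refine Finset.sum_congr rfl fun c _ => ?_
        rw [monomialAt_insert ha, monomialAt_insert hb.1, pairProduct_cons]
        simp only [pairProduct, List.map_nil, List.prod_nil]
        ring)
    simp only [pairProduct, List.map_nil, List.prod_nil, one_mul, hr S hs', hs',
      List.length_nil, Nat.cast_zero, mul_zero, sub_zero] at key
    rw [eq_div_iff hne, ← key]
    ring

/-- A `t`-design is an `s`-design for `s ≤ t`, by double counting; `t ≤ w` keeps the divisor `w - s`
nonzero. -/
theorem exists_sum_monomialAt_eq_of_le {t : ℕ}
    {W : Finset (Fin n → ZMod 2)} {w : ℕ} (hW : ∀ c ∈ W, hammingNorm c = w) (hw : t ≤ w)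
    (H : ∃ r : ℝ, ∀ S : Finset (Fin n), S.card = t → ∑ c ∈ W, monomialAt S c = r)
    (s : ℕ) (hs : s ≤ t) :
    ∃ r : ℝ, ∀ S : Finset (Fin n), S.card = s → ∑ c ∈ W, monomialAt S c = r := by
  induction hs using Nat.decreasingInduction with
  | self => exact H
  | of_succ s hst ih =>
    obtain ⟨r, hr⟩ := ih
    have hne : ((w : ℝ) - s) ≠ 0 := by
      have : (s : ℝ) < w := by exact_mod_cast (by omega : s < w)
      linarith
    refine ⟨((n : ℝ) - s) * r / (w - s), fun S hS => ?_⟩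
    have key := card_mul_sum_insert (S := S) (l := []) (by simp [points]) (by simp [points]) hW
      (r := r) (by
        intro b hb
        rw [mem_freePoints] at hb
        simpa [pairProduct] using hr (insert b S) (by rw [Finset.card_insert_of_notMem hb.1, hS]))
    simp only [pairProduct, List.map_nil, List.prod_nil, one_mul, hS,
      List.length_nil, Nat.cast_zero, mul_zero, sub_zero] at key
    rw [eq_div_iff hne, key]
    ring

/-- Expanding one factor `c a - c b` gives a difference of two sums of the same shape; at the last
pair both equal `r`. -/
theorem sum_pairProduct_eq_zero_of_sum_monomialAt {s : ℕ} {W : Finset (Fin n → ZMod 2)} {r : ℝ}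
    (hr : ∀ S : Finset (Fin n), S.card = s → ∑ c ∈ W, monomialAt S c = r)
    (l : List (Fin n × Fin n)) :
    ∀ S : Finset (Fin n), l.length + S.card = s → (points l).Nodup →
      Disjoint S (points l).toFinset → 1 ≤ l.length →
      ∑ c ∈ W, pairProduct l c * monomialAt S c = 0 := by
  induction l with
  | nil => intro S _ _ _ h; simp at h
  | cons p l ih =>
    obtain ⟨a, b⟩ := p
    intro S hS hl hd _
    rw [points_cons] at hl hd
    simp only [List.nodup_cons, List.mem_cons, not_or] at hl
    rw [List.toFinset_cons, List.toFinset_cons, Finset.disjoint_insert_right,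
      Finset.disjoint_insert_right] at hd
    obtain ⟨⟨hab, ha⟩, hb, hl⟩ := hl
    obtain ⟨haS, hbS, hd⟩ := hd
    rw [List.length_cons] at hS
    have hsplit : ∑ c ∈ W, pairProduct ((a, b) :: l) c * monomialAt S c =
        ∑ c ∈ W, pairProduct l c * monomialAt (insert a S) c -
          ∑ c ∈ W, pairProduct l c * monomialAt (insert b S) c := by
      rw [← Finset.sum_sub_distrib]
      refine Finset.sum_congr rfl fun c _ => ?_
      rw [monomialAt_insert haS, monomialAt_insert hbS, pairProduct_cons]
      ring
    rw [hsplit]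
    have hca := Finset.card_insert_of_notMem haS
    have hcb := Finset.card_insert_of_notMem hbS
    rcases Nat.eq_zero_or_pos l.length with h0 | h0
    · rw [List.length_eq_zero_iff] at h0
      subst h0
      simp only [pairProduct, List.map_nil, List.prod_nil, one_mul]
      simp only [List.length_nil] at hS
      rw [hr _ (by omega), hr _ (by omega), sub_self]
    · rw [ih (insert a S) (by omega) hl (by
          rw [Finset.disjoint_insert_left]; exact ⟨by simpa using ha, hd⟩) h0,
        ih (insert b S) (by omega) hl (by
          rw [Finset.disjoint_insert_left]; exact ⟨by simpa using hb, hd⟩) h0, sub_self]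

/-! ### Support designs through codewords -/

/-- The codewords of weight `w`. -/
noncomputable def codewordsOfWeight (C : Submodule (ZMod 2) (Fin n → ZMod 2)) (w : ℕ) :
    Finset (Fin n → ZMod 2) :=
  open Classical in Finset.univ.filter fun c => c ∈ C ∧ hammingNorm c = w

theorem mem_codewordsOfWeight {C : Submodule (ZMod 2) (Fin n → ZMod 2)} {w : ℕ}
    {c : Fin n → ZMod 2} : c ∈ codewordsOfWeight C w ↔ c ∈ C ∧ hammingNorm c = w := by
  simp [codewordsOfWeight]

theorem wordSupport_injective : Function.Injective (wordSupport : (Fin n → ZMod 2) → _) := by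
  intro c d h
  funext i
  have hi : c i ≠ 0 ↔ d i ≠ 0 := by
    have := congrArg (fun B => i ∈ B) h
    simpa [wordSupport] using this
  generalize c i = x at hi
  generalize d i = y at hi
  revert hi
  revert x y
  decide

/-- `monomialAt T` is the indicator of `T ⊆ wordSupport c`, and a binary word is determined by its
support. -/
theorem ncard_blocks_eq (C : Submodule (ZMod 2) (Fin n → ZMod 2)) (w : ℕ)
    (T : Finset (Fin n)) :
    (({B | B ∈ supportDesign C w ∧ T ⊆ B}.ncard : ℕ) : ℝ) =
      ∑ c ∈ codewordsOfWeight C w, monomialAt T c := by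
  classical
  have h1 : {B | B ∈ supportDesign C w ∧ T ⊆ B} =
      ((((codewordsOfWeight C w).filter fun c => T ⊆ wordSupport c).image wordSupport :
        Finset (Finset (Fin n))) : Set (Finset (Fin n))) := by
    ext B
    simp only [supportDesign, Set.mem_ofPred_eq, Finset.coe_image, Finset.coe_filter,
      mem_codewordsOfWeight, Set.mem_image]
    constructor
    · rintro ⟨⟨c, hc, hw, rfl⟩, hT⟩
      exact ⟨c, ⟨⟨hc, hw⟩, hT⟩, rfl⟩
    · rintro ⟨c, ⟨⟨hc, hw⟩, hT⟩, rfl⟩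
      exact ⟨⟨c, hc, hw, rfl⟩, hT⟩
  rw [h1, Set.ncard_coe_finset, Finset.card_image_of_injective _ wordSupport_injective,
    Finset.card_filter]
  push_cast
  refine Finset.sum_congr rfl fun c _ => ?_
  unfold monomialAt
  split_ifs with h
  · refine (Finset.prod_eq_one fun i hi => ?_).symm
    have := h hi
    simp only [wordSupport, Finset.mem_filter] at this
    simp [bit, this.2]
  · rw [Finset.not_subset] at h
    obtain ⟨i, hi, hiT⟩ := h
    refine (Finset.prod_eq_zero hi ?_).symm
    simp only [wordSupport, Finset.mem_filter, Finset.mem_univ, true_and, not_not] at hiT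
    simp [bit, hiT]

/-- A support design is a `t`-design exactly if the pair products of degrees `1, …, t` sum to
zero over its blocks. -/
theorem isTDesign_supportDesign_iff (C : Submodule (ZMod 2) (Fin n → ZMod 2)) {t w : ℕ}
    (hw : t ≤ w) (hn : 2 * t ≤ n) :
    IsTDesign t (supportDesign C w) ↔
      ∀ l : List (Fin n × Fin n), (points l).Nodup → 1 ≤ l.length → l.length ≤ t →
        ∑ c ∈ codewordsOfWeight C w, pairProduct l c = 0 := by
  have hW : ∀ c ∈ codewordsOfWeight C w, hammingNorm c = w := fun c hc =>
    (mem_codewordsOfWeight.mp hc).2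
  constructor
  · rintro ⟨k, r, h⟩ l hl h1 h2
    obtain ⟨q, hq⟩ := exists_sum_monomialAt_eq_of_le hW hw
      ⟨(r : ℝ), fun S hS => by rw [← ncard_blocks_eq, h.card_containing S hS]⟩ l.length h2
    simpa [monomialAt] using
      sum_pairProduct_eq_zero_of_sum_monomialAt hq l ∅ (by simp) hl (by simp) h1
  · intro H
    obtain ⟨r, hr⟩ := exists_sum_monomialAt_eq hW hn H t le_rfl
    obtain ⟨T₀, -, hT₀⟩ := Finset.exists_subset_card_eq
      (s := (Finset.univ : Finset (Fin n))) (n := t) (by simp; omega)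
    refine ⟨w, {B | B ∈ supportDesign C w ∧ T₀ ⊆ B}.ncard, rfl, ?_, fun T hT => ?_⟩
    · rintro B ⟨c, -, hc, rfl⟩
      exact hc
    · have : (({B | B ∈ supportDesign C w ∧ T ⊆ B}.ncard : ℕ) : ℝ) =
          ({B | B ∈ supportDesign C w ∧ T₀ ⊆ B}.ncard : ℕ) := by
        rw [ncard_blocks_eq, ncard_blocks_eq, hr T hT, hr T₀ hT₀]
      exact_mod_cast this

/-! ### Characters and Poisson summation -/

/-- The nontrivial character of `ZMod 2`. -/
noncomputable def sgn (z : ZMod 2) : ℝ := if z = 0 then 1 else -1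

theorem sgn_zero : sgn 0 = 1 := by simp [sgn]

theorem sgn_one : sgn 1 = -1 := by simp [sgn]

theorem zmod_two_cases (z : ZMod 2) : z = 0 ∨ z = 1 := by
  revert z; decide

theorem sgn_add (x y : ZMod 2) : sgn (x + y) = sgn x * sgn y := by
  rcases zmod_two_cases x with rfl | rfl <;> rcases zmod_two_cases y with rfl | rfl <;>
    simp [sgn_zero, sgn_one, (by decide : (1 : ZMod 2) + 1 = 0)]

theorem sum_zmod_two (f : ZMod 2 → ℝ) : ∑ z : ZMod 2, f z = f 0 + f 1 :=
  Fin.sum_univ_two f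

theorem sgn_sum {ι : Type*} (s : Finset ι) (f : ι → ZMod 2) :
    sgn (∑ i ∈ s, f i) = ∏ i ∈ s, sgn (f i) := by
  classical
  induction s using Finset.induction_on with
  | empty => simp [sgn_zero]
  | insert a s ha ih => rw [Finset.sum_insert ha, Finset.prod_insert ha, sgn_add, ih]

/-- The words of a code as a finite set. -/
noncomputable def codewords (C : Submodule (ZMod 2) (Fin n → ZMod 2)) :
    Finset (Fin n → ZMod 2) :=
  open Classical in Finset.univ.filter fun c => c ∈ C

theorem mem_codewords {C : Submodule (ZMod 2) (Fin n → ZMod 2)} {c : Fin n → ZMod 2} :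
    c ∈ codewords C ↔ c ∈ C := by
  simp [codewords]

theorem sum_sgn_of_mem {C : Submodule (ZMod 2) (Fin n → ZMod 2)} {v : Fin n → ZMod 2}
    (hv : v ∈ dualCode C) :
    ∑ u ∈ codewords C, sgn (∑ i, v i * u i) = (codewords C).card := by
  rw [Finset.sum_congr rfl (g := fun _ => (1 : ℝ))]
  · simp
  · intro u hu
    rw [hv u (mem_codewords.mp hu), sgn_zero]

/-- Translation by a codeword `d` not orthogonal to `v` permutes the code and flips every sign. -/
theorem sum_sgn_of_notMem {C : Submodule (ZMod 2) (Fin n → ZMod 2)} {v : Fin n → ZMod 2}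
    (hv : v ∉ dualCode C) :
    ∑ u ∈ codewords C, sgn (∑ i, v i * u i) = 0 := by
  have : ∃ d ∈ C, ∑ i, v i * d i ≠ 0 := by
    by_contra! h
    exact hv h
  obtain ⟨d, hd, hvd⟩ := this
  have h1 : sgn (∑ i, v i * d i) = -1 := by simp [sgn, hvd]
  have h2 : ∑ u ∈ codewords C, sgn (∑ i, v i * u i) =
      ∑ u ∈ codewords C, sgn (∑ i, v i * (u + d) i) :=
    (Finset.sum_bij (fun u _ => u + d)
      (fun u hu => mem_codewords.mpr (C.add_mem (mem_codewords.mp hu) hd))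
      (fun u _ u' _ h => add_right_cancel h)
      (fun u hu => ⟨u - d, mem_codewords.mpr (C.sub_mem (mem_codewords.mp hu) hd), by simp⟩)
      (fun u _ => rfl)).symm
  have h3 : ∀ u : Fin n → ZMod 2,
      sgn (∑ i, v i * (u + d) i) = - sgn (∑ i, v i * u i) := by
    intro u
    simp only [Pi.add_apply, mul_add, Finset.sum_add_distrib]
    rw [sgn_add, h1]
    ring
  simp only [h3, Finset.sum_neg_distrib] at h2
  linarith

/-- Poisson summation for a linear code. -/
theorem sum_fourier (C : Submodule (ZMod 2) (Fin n → ZMod 2)) (F : (Fin n → ZMod 2) → ℝ) :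
    ∑ u ∈ codewords C, ∑ v, F v * sgn (∑ i, v i * u i) =
      (codewords C).card * ∑ v ∈ codewords (dualCode C), F v := by
  rw [Finset.sum_comm]
  simp only [← Finset.mul_sum]
  rw [Finset.mul_sum, codewords.eq_1 (dualCode C), Finset.sum_filter]
  refine Finset.sum_congr rfl fun v _ => ?_
  split_ifs with hv
  · rw [sum_sgn_of_mem hv, mul_comm]
  · rw [sum_sgn_of_notMem hv, mul_zero]

/-- Poisson summation for the constant `1`, whose transform is `2 ^ n` at `0` and zero elsewhere. -/
theorem card_codewords_sq {C : Submodule (ZMod 2) (Fin n → ZMod 2)} (hC : dualCode C = C) :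
    ((codewords C).card : ℝ) ^ 2 = 2 ^ n := by
  have h := sum_fourier C fun _ => 1
  rw [hC] at h
  simp only [one_mul, Finset.sum_const, nsmul_eq_mul, mul_one] at h
  rw [sq, ← h]
  have h2 : ∀ u : Fin n → ZMod 2, ∑ v : Fin n → ZMod 2, sgn (∑ i, v i * u i) =
      if u = 0 then 2 ^ n else 0 := by
    intro u
    simp only [sgn_sum]
    rw [← Fintype.prod_sum (f := fun i (z : ZMod 2) => sgn (z * u i))]
    have h3 : ∀ i, ∑ z : ZMod 2, sgn (z * u i) = if u i = 0 then 2 else 0 := by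
      intro i
      have : ∑ z : ZMod 2, sgn (z * u i) = sgn (0 * u i) + sgn (1 * u i) :=
        sum_zmod_two _
      rw [this, zero_mul, one_mul, sgn_zero]
      rcases zmod_two_cases (u i) with h | h <;> rw [h]
      · norm_num [sgn_zero]
      · norm_num [sgn_one]
    simp only [h3]
    split_ifs with hu
    · simp [hu]
    · obtain ⟨i, hi⟩ := Function.ne_iff.mp hu
      exact Finset.prod_eq_zero (Finset.mem_univ i) (by simpa using hi)
  simp only [h2, Finset.sum_ite_eq', mem_codewords, C.zero_mem, if_true]

/-- A sum over all words of a pair product times a function that factors over the coordinates. -/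
theorem sum_pairProduct_mul_prod (l : List (Fin n × Fin n)) (hl : (points l).Nodup)
    (ψ : Fin n → ZMod 2 → ℝ) :
    ∑ v : Fin n → ZMod 2, pairProduct l v * ∏ i, ψ i (v i) =
      (l.map fun p => ψ p.1 1 * ψ p.2 0 - ψ p.1 0 * ψ p.2 1).prod *
        ∏ i ∈ Finset.univ \ (points l).toFinset, (ψ i 0 + ψ i 1) := by
  induction l generalizing ψ with
  | nil =>
    simp only [pairProduct, points, List.map_nil, List.prod_nil, one_mul, List.flatMap_nil,
      List.toFinset_nil, Finset.sdiff_empty]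
    rw [← Fintype.prod_sum]
    simp only [sum_zmod_two]
  | cons p l ih =>
    obtain ⟨a, b⟩ := p
    rw [points_cons] at hl ⊢
    simp only [List.nodup_cons, List.mem_cons, not_or] at hl
    obtain ⟨⟨hab, ha⟩, hb, hl⟩ := hl
    set R := Finset.univ \ (a :: b :: points l).toFinset with hR
    have hRa : a ∉ insert b R := by simp [hR, hab]
    have hRb : b ∉ R := by simp [hR]
    have hins : Finset.univ \ (points l).toFinset = insert a (insert b R) := by
      ext i
      simp only [hR, Finset.mem_sdiff, Finset.mem_univ, true_and, Finset.mem_insert,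
        List.mem_toFinset, List.mem_cons]
      by_cases h1 : i = a
      · simp [h1, ha]
      by_cases h2 : i = b
      · simp [h2, hb]
      simp [h1, h2]
    -- A factor `bit (v d)` only alters `ψ d`, so the induction runs over all `ψ`.
    have absorb : ∀ d, ∀ v : Fin n → ZMod 2,
        bit (v d) * ∏ i, ψ i (v i) =
          ∏ i, Function.update ψ d (fun z => bit z * ψ d z) i (v i) := by
      intro d v
      rw [← Finset.mul_prod_erase _ _ (Finset.mem_univ d),
        ← Finset.mul_prod_erase _ (fun i => Function.update ψ d _ i (v i)) (Finset.mem_univ d),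
        Function.update_self, mul_assoc]
      congr 2
      refine Finset.prod_congr rfl fun i hi => ?_
      rw [Function.update_of_ne (Finset.ne_of_mem_erase hi)]
    have hlist : ∀ d, d ∉ points l → ∀ g : ZMod 2 → ℝ,
        (l.map fun p => Function.update ψ d g p.1 1 * Function.update ψ d g p.2 0 -
          Function.update ψ d g p.1 0 * Function.update ψ d g p.2 1) =
        l.map fun p => ψ p.1 1 * ψ p.2 0 - ψ p.1 0 * ψ p.2 1 := by
      intro d hd g
      refine List.map_congr_left fun p hp => ?_
      have h1 : p.1 ≠ d := fun h => hd (List.mem_flatMap.mpr ⟨p, hp, by simp [h]⟩)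
      have h2 : p.2 ≠ d := fun h => hd (List.mem_flatMap.mpr ⟨p, hp, by simp [h]⟩)
      rw [Function.update_of_ne h1, Function.update_of_ne h2]
    have hrest : ∀ d, d ∉ R → ∀ g : ZMod 2 → ℝ,
        ∏ i ∈ R, (Function.update ψ d g i 0 + Function.update ψ d g i 1) =
          ∏ i ∈ R, (ψ i 0 + ψ i 1) := by
      intro d hd g
      refine Finset.prod_congr rfl fun i hi => ?_
      rw [Function.update_of_ne (ne_of_mem_of_not_mem hi hd)]
    have hRa' : a ∉ R := fun h => hRa (Finset.mem_insert_of_mem h)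
    have hsplit : ∑ v : Fin n → ZMod 2, pairProduct ((a, b) :: l) v * ∏ i, ψ i (v i) =
        ∑ v : Fin n → ZMod 2, pairProduct l v *
            ∏ i, Function.update ψ a (fun z => bit z * ψ a z) i (v i) -
          ∑ v : Fin n → ZMod 2, pairProduct l v *
            ∏ i, Function.update ψ b (fun z => bit z * ψ b z) i (v i) := by
      rw [← Finset.sum_sub_distrib]
      refine Finset.sum_congr rfl fun v _ => ?_
      rw [← absorb a, ← absorb b, pairProduct_cons]
      ring
    rw [hsplit, ih hl, ih hl, hlist a ha, hlist b hb, hins, Finset.prod_insert hRa,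
      Finset.prod_insert hRb, Finset.prod_insert hRa, Finset.prod_insert hRb,
      hrest a hRa', hrest b hRb, Function.update_self, Function.update_self,
      Function.update_of_ne hab, Function.update_of_ne (Ne.symm hab), bit_zero, bit_one,
      List.map_cons, List.prod_cons]
    ring

/-! ### Harmonic weights -/

/-- The harmonic weight of a word: a pair product times the weight monomial of the points outside
of the pairs. -/
noncomputable def harmonicWeight (l : List (Fin n × Fin n)) (x y : ℝ) (c : Fin n → ZMod 2) : ℝ :=
  pairProduct l c * ∏ i ∈ Finset.univ \ (points l).toFinset, if c i = 0 then x else y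

/-- The Fourier transform of the harmonic weight. -/
theorem fourier_harmonicWeight (l : List (Fin n × Fin n)) (hl : (points l).Nodup) (x y : ℝ)
    (u : Fin n → ZMod 2) :
    ∑ v, harmonicWeight l x y v * sgn (∑ i, v i * u i) =
      (-2) ^ l.length * harmonicWeight l (x + y) (x - y) u := by
  have h1 : ∀ v : Fin n → ZMod 2, harmonicWeight l x y v * sgn (∑ i, v i * u i) =
      pairProduct l v * ∏ i, ((if i ∈ Finset.univ \ (points l).toFinset then
        (if v i = 0 then x else y) else 1) * sgn (v i * u i)) := by
    intro v
    rw [Finset.prod_mul_distrib, sgn_sum, harmonicWeight, Finset.prod_ite_mem,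
      Finset.univ_inter, mul_assoc]
  simp only [h1]
  rw [sum_pairProduct_mul_prod l hl (fun i z => (if i ∈ Finset.univ \ (points l).toFinset then
        (if z = 0 then x else y) else 1) * sgn (z * u i)), harmonicWeight, ← mul_assoc]
  congr 1
  · have h2 : ∀ p ∈ l, p.1 ∈ points l ∧ p.2 ∈ points l := fun p hp =>
      ⟨List.mem_flatMap.mpr ⟨p, hp, by simp⟩, List.mem_flatMap.mpr ⟨p, hp, by simp⟩⟩
    have h3 : ∀ z : ZMod 2, sgn z = 1 - 2 * bit z := by
      intro z
      rcases zmod_two_cases z with rfl | rfl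
      · norm_num [sgn_zero, bit_zero]
      · norm_num [sgn_one, bit_one]
    -- Each pair contributes `sgn (u a) - sgn (u b)`, hence one factor `-2`.
    rw [pairProduct, List.map_congr_left (g := fun p => -2 * (bit (u p.1) - bit (u p.2)))]
    · rw [List.prod_map_mul, List.map_const', List.prod_replicate]
    · intro p hp
      simp only [bit_zero, Finset.mem_sdiff, Finset.mem_univ, List.mem_toFinset, h2 p hp, not_true_eq_false,
        and_false, if_false, one_mul, zero_mul, h3]
      ring
  · refine Finset.prod_congr rfl fun i hi => ?_
    rw [if_pos hi, if_pos hi, if_pos rfl, if_neg (by decide), zero_mul, one_mul, sgn_zero]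
    unfold sgn
    split_ifs <;> ring

/-- Where the pair product is nonzero the pairs use up `l.length` ones and as many zeros, which
fixes the exponents of `x` and `y`. -/
theorem harmonicWeight_eq {l : List (Fin n × Fin n)} (hl : (points l).Nodup) (x y : ℝ)
    {c : Fin n → ZMod 2} {i j : ℕ} (h1 : hammingNorm c = l.length + j)
    (h2 : n = 2 * l.length + i + j) :
    harmonicWeight l x y c = pairProduct l c * (x ^ i * y ^ j) := by
  by_cases h0 : pairProduct l c = 0
  · simp [harmonicWeight, h0]
  rw [harmonicWeight, Finset.prod_ite, Finset.prod_const, Finset.prod_const]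
  have hsum := mul_left_cancel₀ h0 (pairProduct_mul_sum hl c)
  have htot := Finset.sum_sdiff (f := fun i => bit (c i))
    (Finset.subset_univ (points l).toFinset)
  rw [sum_bit, hsum, h1] at htot
  have hj : ((Finset.univ \ (points l).toFinset).filter fun i => ¬ c i = 0).card = j := by
    rw [Finset.card_filter]
    have : ∑ i ∈ Finset.univ \ (points l).toFinset, bit (c i) =
        ((∑ i ∈ Finset.univ \ (points l).toFinset, if ¬ c i = 0 then 1 else 0 : ℕ) : ℝ) := by
      push_cast
      refine Finset.sum_congr rfl fun i _ => ?_
      unfold bit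
      split_ifs <;> simp_all
    rw [this] at htot
    push_cast at htot ⊢
    have h' : ((∑ i ∈ Finset.univ \ (points l).toFinset,
        if ¬ c i = 0 then 1 else 0 : ℕ) : ℝ) = j := by
      push_cast
      linarith
    exact_mod_cast h'
  have hi := Finset.card_filter_add_card_filter_not
    (s := Finset.univ \ (points l).toFinset) (fun i => c i = 0)
  have hc := Finset.card_sdiff_add_card_eq_card (Finset.subset_univ (points l).toFinset)
  rw [List.toFinset_card_of_nodup hl, length_points, Finset.card_univ, Fintype.card_fin] at hc
  rw [hj, show ((Finset.univ \ (points l).toFinset).filter fun i => c i = 0).card = i by omega]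

/-! ### Relative invariants under `(x, y) ↦ (x + y, x - y)` -/

section Polynomials

open Polynomial

/-- Since `1` is a simple root of `X ^ 4 - 1`, substituting `X ^ 4` for `X` preserves the
multiplicity of the root `1`. -/
theorem X_sub_one_pow_dvd_of_expand {G : ℝ[X]} {e : ℕ}
    (h : (X - 1 : ℝ[X]) ^ e ∣ expand ℝ 4 G) : (X - 1 : ℝ[X]) ^ e ∣ G := by
  by_cases hG : G = 0
  · simp [hG]
  obtain ⟨q, hq, hndvd⟩ := exists_eq_pow_rootMultiplicity_mul_and_not_dvd G hG 1
  rw [C_1] at hq hndvd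
  set k := rootMultiplicity 1 G
  have hle : e ≤ k := by
    by_contra! hlt
    apply hndvd
    have h1 : (X - 1 : ℝ[X]) ^ (k + 1) ∣
        (X - 1) ^ k * ((1 + X + X ^ 2 + X ^ 3) ^ k * expand ℝ 4 q) := by
      refine (pow_dvd_pow _ hlt).trans (h.trans (dvd_of_eq ?_))
      rw [hq]
      simp only [map_mul, map_pow, map_sub, expand_X, map_one]
      rw [show (X ^ 4 - 1 : ℝ[X]) = (X - 1) * (1 + X + X ^ 2 + X ^ 3) by ring, mul_pow]
      ring
    have hX : (X - 1 : ℝ[X]) ≠ 0 := by simpa using X_sub_C_ne_zero (1 : ℝ)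
    rw [pow_succ, mul_dvd_mul_iff_left (pow_ne_zero _ hX)] at h1
    rw [← C_1, dvd_iff_isRoot] at h1 ⊢
    simp only [IsRoot.def, eval_mul, eval_pow, eval_add, eval_X, expand_eval,
      one_pow, mul_eq_zero] at h1
    rcases h1 with h1 | h1
    · exact absurd (eq_zero_of_pow_eq_zero h1) (by norm_num)
    · exact h1
  rw [hq]
  exact (pow_dvd_pow _ hle).mul_right _

theorem coeff_X_sub_one_pow_ne_zero {M k : ℕ} (hk : k ≤ M) :
    ((X - 1 : ℝ[X]) ^ M).coeff k ≠ 0 := by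
  rw [show (X - 1 : ℝ[X]) ^ M = (X + C (-1)) ^ M by simp [sub_eq_add_neg], coeff_X_add_C_pow]
  refine mul_ne_zero (by simp) ?_
  exact_mod_cast (Nat.choose_pos hk).ne'

theorem choose_relation (E k : ℕ) :
    ((E.choose (k + 2) : ℝ) - 14 * E.choose (k + 1) + E.choose k) * ((E + 2) * (E + 1)) =
      (E + 2).choose (k + 2) * ((E + 2) * (E + 1) - 16 * (k + 2) * (E - k)) := by
  have a1 : ((E : ℝ) + 1) * E.choose k = (E + 1).choose (k + 1) * (k + 1) := by
    exact_mod_cast Nat.add_one_mul_choose_eq E k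
  have a2 : ((E : ℝ) + 1) * E.choose (k + 1) = (E + 1).choose (k + 2) * (k + 2) := by
    exact_mod_cast Nat.add_one_mul_choose_eq E (k + 1)
  have a3 : ((E : ℝ) + 2) * (E + 1).choose (k + 1) = (E + 2).choose (k + 2) * (k + 2) := by
    exact_mod_cast Nat.add_one_mul_choose_eq (E + 1) (k + 1)
  have p1 : ((E + 2).choose (k + 2) : ℝ) = (E + 1).choose (k + 1) + (E + 1).choose (k + 2) := by
    exact_mod_cast Nat.choose_succ_succ (E + 1) (k + 1)
  have p2 : ((E + 1).choose (k + 2) : ℝ) = E.choose (k + 1) + E.choose (k + 2) := by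
    exact_mod_cast Nat.choose_succ_succ E (k + 1)
  have c1 : ((E : ℝ) + 2) * (E + 1) * E.choose k = (E + 2).choose (k + 2) * (k + 2) * (k + 1) := by
    linear_combination (E + 2 : ℝ) * a1 + (k + 1 : ℝ) * a3
  have b3 : ((E : ℝ) + 2) * (E + 1).choose (k + 2) = (E + 2).choose (k + 2) * (E - k) := by
    linear_combination -(E + 2 : ℝ) * p1 - a3
  have c2 : ((E : ℝ) + 2) * (E + 1) * E.choose (k + 1) =
      (E + 2).choose (k + 2) * (k + 2) * (E - k) := by
    linear_combination (E + 2 : ℝ) * a2 + (k + 2 : ℝ) * b3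
  have c3 : ((E : ℝ) + 2) * (E + 1) * E.choose (k + 2) =
      (E + 2).choose (k + 2) * (E - k) * (E - k - 1) := by
    linear_combination -((E : ℝ) + 2) * (E + 1) * p2 - c2 + (E + 1) * b3
  linear_combination c3 - 14 * c2 + c1

/-- By `choose_relation`, a zero coefficient in degree at least `2` would give `(E + 2) * (E + 1) =
16 * (k + 2) * (E - k)`; for `4 ∣ E` the left side is `2` modulo `4`. -/
theorem coeff_mul_quadratic_ne_zero {E k : ℕ} (hE : 4 ∣ E) (hk : k ≤ E + 2) :
    ((X - 1 : ℝ[X]) ^ E * (1 + 14 * X + X ^ 2)).coeff k ≠ 0 := by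
  have hexp : (X - 1 : ℝ[X]) ^ E * (1 + 14 * X + X ^ 2) =
      (X - 1) ^ E + C 14 * ((X - 1) ^ E * X) + (X - 1) ^ E * X ^ 2 := by
    rw [show (C 14 : ℝ[X]) = 14 from rfl]
    ring
  have heven : Even E := even_iff_two_dvd.mpr ((by norm_num : (2 : ℕ) ∣ 4).trans hE)
  have hc : ∀ j, ((X - 1 : ℝ[X]) ^ E).coeff j = (-1) ^ j * E.choose j := by
    intro j
    rw [show (X - 1 : ℝ[X]) ^ E = (X + C (-1)) ^ E by simp [sub_eq_add_neg], coeff_X_add_C_pow]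
    rcases le_or_gt j E with hj | hj
    · congr 1
      have : (-1 : ℝ) ^ (E - j) * (-1) ^ j = 1 := by
        rw [← pow_add, Nat.sub_add_cancel hj, heven.neg_one_pow]
      have h2 : (-1 : ℝ) ^ j * (-1) ^ j = 1 := by
        rw [← mul_pow]; norm_num
      calc (-1 : ℝ) ^ (E - j) = (-1 : ℝ) ^ (E - j) * ((-1) ^ j * (-1) ^ j) := by rw [h2, mul_one]
        _ = (-1) ^ j := by rw [← mul_assoc, this, one_mul]
    · simp [Nat.choose_eq_zero_of_lt hj]
  obtain ⟨r, rfl⟩ := hE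
  rw [hexp, coeff_add, coeff_add, coeff_C_mul]
  match k with
  | 0 =>
    rw [coeff_mul_X_zero, coeff_mul_X_pow', hc]
    simp
  | 1 =>
    rw [coeff_mul_X, coeff_mul_X_pow', hc, hc]
    simp only [pow_one, Nat.choose_one_right, pow_zero, Nat.choose_zero_right]
    intro h
    norm_num at h
    have h' : (4 * r : ℝ) = 14 := by linarith
    have : 4 * r = 14 := by exact_mod_cast h'
    omega
  | k + 2 =>
    rw [show k + 2 = (k + 1) + 1 from rfl, coeff_mul_X, hc, hc,
      show k + 1 + 1 = k + 2 from rfl, coeff_mul_X_pow, hc]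
    intro h
    have h1 : (((4 * r).choose (k + 2) : ℝ) - 14 * (4 * r).choose (k + 1) + (4 * r).choose k) = 0 := by
      have : (-1 : ℝ) ^ k * (((4 * r).choose (k + 2) : ℝ) - 14 * (4 * r).choose (k + 1) +
          (4 * r).choose k) = 0 := by
        rw [← h]; ring
      exact (mul_eq_zero.mp this).resolve_left (by simp)
    have h2 := choose_relation (4 * r) k
    rw [h1, zero_mul] at h2
    have h3 := (mul_eq_zero.mp h2.symm).resolve_left
      (by exact_mod_cast (Nat.choose_pos hk).ne')
    push_cast at h3
    have h4 : ((4 * r + 2) * (4 * r + 1) - 16 * (k + 2) * (4 * r - k) : ℤ) = 0 := by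
      exact_mod_cast h3
    ring_nf at h4
    omega

/-- A polynomial in `x ^ 4, y ^ 4` of degree `M` times a power of `x * y`, whose value is
preserved up to scaling by `(x, y) ↦ (x + y, x - y)`, is divisible by `(x ^ 4 - y ^ 4) ^ e`. -/
theorem X_sub_one_pow_dvd {G : ℝ[X]} {e M : ℕ} {a : ℕ → ℝ} {K L : ℝ} (hL : L ≠ 0)
    (hG : G = ∑ k ∈ Finset.range (M + 1), C (a k) * X ^ k)
    (hfun : ∀ x y : ℝ,
      K * (((x + y) * (x - y)) ^ e * ∑ k ∈ Finset.range (M + 1),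
        a k * ((x + y) ^ (4 * (M - k)) * (x - y) ^ (4 * k))) =
      L * ((x * y) ^ e * ∑ k ∈ Finset.range (M + 1), a k * (x ^ (4 * (M - k)) * y ^ (4 * k)))) :
    (X - 1 : ℝ[X]) ^ e ∣ G := by
  apply X_sub_one_pow_dvd_of_expand
  have hpoly : C K * (((1 + X) * (1 - X)) ^ e * ∑ k ∈ Finset.range (M + 1),
      C (a k) * ((1 + X) ^ (4 * (M - k)) * (1 - X) ^ (4 * k))) =
      C L * (X ^ e * expand ℝ 4 G) := by
    refine Polynomial.funext fun y => ?_
    have := hfun 1 y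
    simp only [one_mul, one_pow] at this
    simp only [hG, eval_mul, eval_C, eval_pow, eval_add, eval_sub, eval_one, eval_X,
      eval_finsetSum, expand_eval, ← pow_mul]
    exact this
  -- At `x = 1` the left side contains `(1 - X) ^ e`, and `X - 1` is prime to the factor `X ^ e` on
  -- the right.
  have hcop : IsCoprime ((X - 1 : ℝ[X]) ^ e) (C L * X ^ e) := by
    have h0 : IsCoprime ((X - 1 : ℝ[X]) ^ e) (X ^ e) :=
      IsCoprime.pow ⟨-1, 1, by ring⟩
    exact (isCoprime_mul_unit_left_right (isUnit_C.mpr (isUnit_iff_ne_zero.mpr hL)) _ _).mpr h0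
  refine hcop.dvd_of_dvd_mul_left (Dvd.dvd.trans ?_ (dvd_of_eq (hpoly.trans (mul_assoc _ _ _).symm)))
  refine Dvd.dvd.mul_left (Dvd.dvd.mul_right ?_ _) _
  rw [mul_pow]
  refine Dvd.dvd.mul_left ?_ _
  exact pow_dvd_pow_of_dvd ⟨-1, by ring⟩ e

theorem sum_homogenize {G : ℝ[X]} {M : ℕ} {a : ℕ → ℝ}
    (hG : G = ∑ k ∈ Finset.range (M + 1), C (a k) * X ^ k) {x : ℝ} (hx : x ≠ 0) (y : ℝ) :
    ∑ k ∈ Finset.range (M + 1), a k * (x ^ (4 * (M - k)) * y ^ (4 * k)) =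
      x ^ (4 * M) * G.eval ((y / x) ^ 4) := by
  rw [hG, eval_finsetSum, Finset.mul_sum]
  refine Finset.sum_congr rfl fun k hk => ?_
  have hk' : k ≤ M := by simpa [Nat.lt_succ_iff] using hk
  rw [eval_mul, eval_C, eval_pow, eval_X, ← pow_mul, div_pow,
    show 4 * M = 4 * (M - k) + 4 * k by omega, pow_add]
  field_simp

theorem coeff_sum_range (a : ℕ → ℝ) {M k : ℕ} (hk : k ≤ M) :
    (∑ j ∈ Finset.range (M + 1), C (a j) * X ^ j : ℝ[X]).coeff k = a k := by
  simp only [finsetSum_coeff, coeff_C_mul, coeff_X_pow, mul_ite, mul_one, mul_zero]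
  rw [Finset.sum_ite_eq, if_pos (by simp; omega)]

/-- If `G = (X - 1) ^ e * q` then the functional equation descends to `q`. -/
theorem functional_equation_quotient {G q : ℝ[X]} {e d M : ℕ} (hM : M = e + d) {a : ℕ → ℝ} {K L : ℝ}
    (hG : G = ∑ k ∈ Finset.range (M + 1), C (a k) * X ^ k) (hq : G = (X - 1) ^ e * q)
    (hfun : ∀ x y : ℝ,
      K * (((x + y) * (x - y)) ^ e * ∑ k ∈ Finset.range (M + 1),
        a k * ((x + y) ^ (4 * (M - k)) * (x - y) ^ (4 * k))) =
      L * ((x * y) ^ e * ∑ k ∈ Finset.range (M + 1), a k * (x ^ (4 * (M - k)) * y ^ (4 * k))))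
    {y : ℝ} (h0 : y ≠ 0) (h1 : y ^ 4 ≠ 1) (h2 : 1 + y ≠ 0) :
    K * 8 ^ e * ((1 + y) ^ (4 * d) * q.eval (((1 - y) / (1 + y)) ^ 4)) = L * q.eval (y ^ 4) := by
  have h := hfun 1 y
  rw [sum_homogenize hG h2, sum_homogenize hG one_ne_zero, hq] at h
  simp only [eval_mul, eval_pow, eval_sub, eval_X, eval_one, one_mul, one_pow, div_one] at h
  have h3 : (1 + y) ^ (4 * M) = ((1 + y) ^ 4) ^ e * (1 + y) ^ (4 * d) := by
    rw [hM, mul_add, pow_add, pow_mul]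
  -- The form `x * y * (x ^ 4 - y ^ 4)` is a relative invariant with factor `8`; this is its
  -- dehomogenized form.
  have h4 : ((1 + y) * (1 - y)) * (1 + y) ^ 4 * (((1 - y) / (1 + y)) ^ 4 - 1) =
      8 * (y * (y ^ 4 - 1)) := by
    field_simp
    ring
  have h5 : K * (((1 + y) * (1 - y)) ^ e * ((1 + y) ^ (4 * M) *
      ((((1 - y) / (1 + y)) ^ 4 - 1) ^ e * q.eval (((1 - y) / (1 + y)) ^ 4)))) =
      (y * (y ^ 4 - 1)) ^ e *
        (K * 8 ^ e * ((1 + y) ^ (4 * d) * q.eval (((1 - y) / (1 + y)) ^ 4))) := by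
    have h6 := congrArg (· ^ e) h4
    simp only [mul_pow] at h6
    rw [h3, mul_pow, mul_pow]
    linear_combination K * (1 + y) ^ (4 * d) * q.eval (((1 - y) / (1 + y)) ^ 4) * h6
  rw [h5] at h
  refine mul_left_cancel₀ (pow_ne_zero e (mul_ne_zero h0 (sub_ne_zero.mpr h1))) (h.trans ?_)
  rw [mul_pow]
  ring

/-- The coefficients of a relative invariant of degree `24 * m - 2 * t` with `t ≤ 8` that is
divisible by `(x * y) ^ (4 * m + 4 - t)` vanish all or none. -/
theorem coefficients_eq_zero {m t : ℕ} (hm : 1 ≤ m) (ht : t ≤ 8) {a : ℕ → ℝ}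
    (hfun : ∀ x y : ℝ,
      (-2 : ℝ) ^ t * (((x + y) * (x - y)) ^ (4 * m + 4 - t) *
        ∑ k ∈ Finset.range (4 * m - 2 + 1),
          a k * ((x + y) ^ (4 * (4 * m - 2 - k)) * (x - y) ^ (4 * k))) =
      2 ^ (12 * m) * ((x * y) ^ (4 * m + 4 - t) * ∑ k ∈ Finset.range (4 * m - 2 + 1),
        a k * (x ^ (4 * (4 * m - 2 - k)) * y ^ (4 * k))))
    {k₀ : ℕ} (hk₀ : k₀ ≤ 4 * m - 2) (h0 : a k₀ = 0) {k : ℕ} (hk : k ≤ 4 * m - 2) : a k = 0 := by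
  obtain ⟨G, hG⟩ : ∃ G : ℝ[X], G = ∑ k ∈ Finset.range (4 * m - 2 + 1), C (a k) * X ^ k :=
    ⟨_, rfl⟩
  have hcoeff : ∀ k ≤ 4 * m - 2, G.coeff k = a k := fun k hk => by rw [hG, coeff_sum_range a hk]
  rw [← hcoeff k hk]
  rw [← hcoeff k₀ hk₀] at h0
  suffices G = 0 by rw [this, coeff_zero]
  by_contra hne
  have hdeg : G.natDegree ≤ 4 * m - 2 := by
    rw [hG]
    exact natDegree_sum_le_of_forall_le _ _ fun k hk =>
      (natDegree_C_mul_X_pow_le _ _).trans (by simpa [Nat.lt_succ_iff] using hk)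
  obtain ⟨q, hq⟩ := X_sub_one_pow_dvd (by positivity) hG hfun
  have hq0 : q ≠ 0 := by rintro rfl; exact hne (by simpa using hq)
  have hX : (X - 1 : ℝ[X]) ≠ 0 := by simpa using X_sub_C_ne_zero (1 : ℝ)
  have hdq : 4 * m + 4 - t + q.natDegree ≤ 4 * m - 2 := by
    rw [hq, natDegree_mul (pow_ne_zero _ hX) hq0, natDegree_pow,
      show (X - 1 : ℝ[X]).natDegree = 1 by simpa using natDegree_X_sub_C (1 : ℝ), mul_one] at hdeg
    exact hdeg
  -- The degree bound leaves `q.natDegree ≤ t - 6`.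
  have ht6 : 6 ≤ t := by omega
  interval_cases t
  · have hd : q.natDegree = 0 := by omega
    rw [eq_C_of_natDegree_eq_zero hd] at hq
    rw [hq, coeff_mul_C, show 4 * m + 4 - 6 = 4 * m - 2 by omega] at h0
    have := (mul_eq_zero.mp h0).resolve_left (coeff_X_sub_one_pow_ne_zero hk₀)
    exact hq0 (by rw [eq_C_of_natDegree_eq_zero hd, this, C_0])
  · have hd : q.natDegree ≤ 1 := by omega
    have hlin := eq_X_add_C_of_natDegree_le_one hd
    -- The scalar `(-2) ^ 7 * 8 ^ e` equals `-2 ^ (12 * m) / 4`. The equations at `y = 2` and `y =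
    -- 3` are then independent, so `q = 0`.
    have hpow : (8 : ℝ) ^ (4 * m + 4 - 7) * 8 = 2 ^ (12 * m) * (1 / 64) := by
      rw [← pow_succ, show 4 * m + 4 - 7 + 1 = 4 * m - 2 by omega]
      rw [show 12 * m = 3 * (4 * m - 2) + 6 by omega, pow_add, pow_mul]
      norm_num
      ring
    have E : ∀ y : ℝ, y ≠ 0 → y ^ 4 ≠ 1 → 1 + y ≠ 0 → _ := fun y h0 h1 h2 =>
      functional_equation_quotient (d := 1) (by omega) hG hq hfun h0 h1 h2
    have E2 := E 2 (by norm_num) (by norm_num) (by norm_num)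
    have E3 := E 3 (by norm_num) (by norm_num) (by norm_num)
    rw [hlin] at E2 E3
    simp only [eval_add, eval_mul, eval_C, eval_X] at E2 E3
    have hp : (2 : ℝ) ^ (12 * m) ≠ 0 := by positivity
    have F2 : (85 * q.coeff 0 + 65 * q.coeff 1) = 0 := by
      refine mul_left_cancel₀ hp ?_
      norm_num at E2
      linear_combination -4 * E2 - 64 * (81 * q.coeff 0 + q.coeff 1) * hpow
    have F3 : (260 * q.coeff 0 + 340 * q.coeff 1) = 0 := by
      refine mul_left_cancel₀ hp ?_
      norm_num at E3
      linear_combination -4 * E3 - 64 * (256 * q.coeff 0 + 16 * q.coeff 1) * hpow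
    have c0 : q.coeff 0 = 0 := by linarith
    have c1 : q.coeff 1 = 0 := by linarith
    exact hq0 (by rw [hlin, c0, c1]; simp)
  · have hd : q.natDegree < 3 := by omega
    have hquad : q = C (q.coeff 0) + C (q.coeff 1) * X + C (q.coeff 2) * X ^ 2 := by
      conv_lhs => rw [q.as_sum_range_C_mul_X_pow' hd]
      simp [Finset.sum_range_succ]
    -- Here `(-2) ^ 8 * 8 ^ e = 2 ^ (12 * m) / 16`, and the two equations leave only the multiples
    -- of `1 + 14 * X + X ^ 2`, the dehomogenized weight enumerator of the extended Hamming code of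
    -- length `8`.
    have hpow : (8 : ℝ) ^ (4 * m + 4 - 8) * 256 = 2 ^ (12 * m) * (1 / 16) := by
      rw [show 12 * m = 3 * (4 * m + 4 - 8) + 12 by omega, pow_add, pow_mul]
      norm_num
      ring
    have E : ∀ y : ℝ, y ≠ 0 → y ^ 4 ≠ 1 → 1 + y ≠ 0 → _ := fun y h0 h1 h2 =>
      functional_equation_quotient (d := 2) (by omega) hG hq hfun h0 h1 h2
    have E2 := E 2 (by norm_num) (by norm_num) (by norm_num)
    have E3 := E 3 (by norm_num) (by norm_num) (by norm_num)
    rw [hquad] at E2 E3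
    simp only [eval_add, eval_mul, eval_C, eval_X, eval_pow] at E2 E3
    have hp : (2 : ℝ) ^ (12 * m) ≠ 0 := by positivity
    have F2 : 6545 * q.coeff 0 - 175 * q.coeff 1 - 4095 * q.coeff 2 = 0 := by
      refine mul_left_cancel₀ hp ?_
      norm_num at E2
      linear_combination 16 * E2 -
        16 * (6561 * q.coeff 0 + 81 * q.coeff 1 + q.coeff 2) * hpow
    have F3 : 65520 * q.coeff 0 + 2800 * q.coeff 1 - 104720 * q.coeff 2 = 0 := by
      refine mul_left_cancel₀ hp ?_
      norm_num at E3
      linear_combination 16 * E3 -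
        16 * (65536 * q.coeff 0 + 4096 * q.coeff 1 + 256 * q.coeff 2) * hpow
    have c2 : q.coeff 2 = q.coeff 0 := by linarith
    have c1 : q.coeff 1 = q.coeff 0 * 14 := by linarith
    have hq' : q = C (q.coeff 0) * (1 + 14 * X + X ^ 2) := by
      conv_lhs => rw [hquad, c2, c1, C_mul, show (C 14 : ℝ[X]) = 14 from rfl]
      ring
    have hne0 : q.coeff 0 ≠ 0 := fun h => hq0 (by rw [hq', h, C_0, zero_mul])
    have hGq : G = C (q.coeff 0) * ((X - 1) ^ (4 * m + 4 - 8) * (1 + 14 * X + X ^ 2)) := by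
      rw [hq]
      conv_lhs => rw [hq']
      ring
    rw [hGq, coeff_C_mul] at h0
    exact coeff_mul_quadratic_ne_zero (E := 4 * m + 4 - 8) (by omega) (by omega)
      ((mul_eq_zero.mp h0).resolve_left hne0)

end Polynomials

/-! ### Harmonic weight enumerators of extremal codes -/

theorem one_mem_of_selfDual {n : ℕ} {C : Submodule (ZMod 2) (Fin n → ZMod 2)}
    (hC : IsSelfDualCode C) (h4 : IsDoublyEvenCode C) : (1 : Fin n → ZMod 2) ∈ C := by
  rw [← hC]
  intro c hc
  have h : ∀ z : ZMod 2, z = ((if z ≠ 0 then 1 else 0 : ℕ) : ZMod 2) := by decide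
  have : ∑ i, c i = (hammingNorm c : ZMod 2) := by
    rw [hammingNorm, Finset.card_filter, Nat.cast_sum]
    exact Finset.sum_congr rfl fun i _ => h (c i)
  simp only [Pi.one_apply, one_mul]
  rw [this, ZMod.natCast_eq_zero_iff]
  exact (by norm_num : 2 ∣ 4).trans (h4 c hc)

theorem hammingNorm_add_one {n : ℕ} (c : Fin n → ZMod 2) :
    hammingNorm (c + 1) + hammingNorm c = n := by
  have h : ∀ z : ZMod 2, z + 1 ≠ 0 ↔ ¬ z ≠ 0 := by decide
  have := Finset.card_filter_add_card_filter_not (s := (Finset.univ : Finset (Fin n)))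
    (fun i => c i ≠ 0)
  rw [Finset.card_univ, Fintype.card_fin, add_comm] at this
  simpa only [hammingNorm, Pi.add_apply, Pi.one_apply, h] using this

theorem pairProduct_eq_zero_of_const {n : ℕ} {l : List (Fin n × Fin n)} (hl : 1 ≤ l.length)
    {c : Fin n → ZMod 2} {z : ZMod 2} (hc : ∀ i, c i = z) : pairProduct l c = 0 := by
  match l with
  | [] => simp at hl
  | (a, b) :: l => rw [pairProduct_cons, hc, hc, sub_self, zero_mul]

/-- The weights of the codewords that contribute to a pair product. -/
theorem exists_hammingNorm_eq {m n : ℕ} (hn : n = 24 * m) (hm : 1 ≤ m)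
    {C : Submodule (ZMod 2) (Fin n → ZMod 2)} (hC : IsExtremalTypeII C)
    {l : List (Fin n × Fin n)} (hl : 1 ≤ l.length) {c : Fin n → ZMod 2} (hc : c ∈ C)
    (h0 : pairProduct l c ≠ 0) : ∃ k ≤ 4 * m - 2, hammingNorm c = 4 * m + 4 + 4 * k := by
  have hdiv : n / 24 = m := by omega
  have hmin := hC.minimumWeight.2
  rw [hdiv] at hmin
  have h1 : 4 * m + 4 ≤ hammingNorm c := hmin ⟨c, hc, fun h =>
    h0 (pairProduct_eq_zero_of_const hl (z := 0) fun i => by rw [h]; rfl), rfl⟩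
  -- The complement is also a codeword, so the minimum weight bounds `hammingNorm c` from above too;
  -- the zero and all-ones words are excluded because pair products vanish on constant words.
  have h2 : 4 * m + 4 ≤ hammingNorm (c + 1) := hmin ⟨c + 1,
    C.add_mem hc (one_mem_of_selfDual hC.selfDual hC.doublyEven), fun h =>
      h0 (pairProduct_eq_zero_of_const hl (z := 1) fun i => by
        have hi : c i + 1 = 0 := congrFun h i
        revert hi
        generalize c i = x
        revert x
        decide), rfl⟩
  have h3 := hammingNorm_add_one c
  obtain ⟨r, hr⟩ := hC.doublyEven c hc
  exact ⟨r - (m + 1), by omega, by omega⟩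

/-- The harmonic weight enumerator of an extremal code, sorted by weights. -/
theorem sum_harmonicWeight_eq {m n : ℕ} (hn : n = 24 * m) (hm : 1 ≤ m)
    {C : Submodule (ZMod 2) (Fin n → ZMod 2)} (hC : IsExtremalTypeII C)
    {l : List (Fin n × Fin n)} (hnd : (points l).Nodup) (hl : 1 ≤ l.length) (hl8 : l.length ≤ 8)
    (x y : ℝ) :
    ∑ c ∈ codewords C, harmonicWeight l x y c =
      (x * y) ^ (4 * m + 4 - l.length) * ∑ k ∈ Finset.range (4 * m - 2 + 1),
        (∑ c ∈ codewordsOfWeight C (4 * m + 4 + 4 * k), pairProduct l c) *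
          (x ^ (4 * (4 * m - 2 - k)) * y ^ (4 * k)) := by
  classical
  have hw : ∀ k ≤ 4 * m - 2, ∀ c : Fin n → ZMod 2, hammingNorm c = 4 * m + 4 + 4 * k →
      harmonicWeight l x y c = (x * y) ^ (4 * m + 4 - l.length) *
        (pairProduct l c * (x ^ (4 * (4 * m - 2 - k)) * y ^ (4 * k))) := by
    intro k hk c hc
    -- As `n = 24 * m`, both exponents are at least `4 * m + 4 - l.length`, with excess divisible by
    -- `4`.
    rw [harmonicWeight_eq hnd x y (i := 4 * m + 4 - l.length + 4 * (4 * m - 2 - k))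
      (j := 4 * m + 4 - l.length + 4 * k) (by omega) (by omega), pow_add, pow_add, mul_pow]
    ring
  rw [Finset.mul_sum]
  simp only [Finset.sum_mul, Finset.mul_sum]
  have h1 : ∀ k ∈ Finset.range (4 * m - 2 + 1),
      ∑ c ∈ codewordsOfWeight C (4 * m + 4 + 4 * k), (x * y) ^ (4 * m + 4 - l.length) *
        (pairProduct l c * (x ^ (4 * (4 * m - 2 - k)) * y ^ (4 * k))) =
      ∑ c ∈ codewords C,
        if hammingNorm c = 4 * m + 4 + 4 * k then harmonicWeight l x y c else 0 := by
    intro k hk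
    rw [← Finset.sum_filter]
    refine Finset.sum_congr ?_ fun c hc => ?_
    · ext c
      simp [mem_codewordsOfWeight, mem_codewords]
    · rw [Finset.mem_filter] at hc
      rw [hw k (by simpa [Nat.lt_succ_iff] using hk) c hc.2]
  rw [Finset.sum_congr rfl h1, Finset.sum_comm]
  refine Finset.sum_congr rfl fun c hc => ?_
  by_cases h0 : pairProduct l c = 0
  · simp [harmonicWeight, h0]
  · obtain ⟨k, hk, hck⟩ := exists_hammingNorm_eq hn hm hC hl (mem_codewords.mp hc) h0
    rw [Finset.sum_eq_single_of_mem k (by simp; omega), if_pos hck]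
    intro j _ hj
    rw [if_neg (by omega)]

theorem sum_pairProduct_eq_zero {m n : ℕ} (hn : n = 24 * m) (hm : 1 ≤ m)
    {C : Submodule (ZMod 2) (Fin n → ZMod 2)} (hC : IsExtremalTypeII C)
    {l : List (Fin n × Fin n)} (hnd : (points l).Nodup) (hl : 1 ≤ l.length) (hl8 : l.length ≤ 8)
    {k₀ k : ℕ} (hk₀ : k₀ ≤ 4 * m - 2) (hk : k ≤ 4 * m - 2)
    (h0 : ∑ c ∈ codewordsOfWeight C (4 * m + 4 + 4 * k₀), pairProduct l c = 0) :
    ∑ c ∈ codewordsOfWeight C (4 * m + 4 + 4 * k), pairProduct l c = 0 := by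
  have hdual : dualCode C = C := hC.selfDual
  have hcard : ((codewords C).card : ℝ) = 2 ^ (12 * m) := by
    have := card_codewords_sq hdual
    rw [show (2 : ℝ) ^ n = (2 ^ (12 * m)) ^ 2 by rw [hn, ← pow_mul]; congr 1; ring] at this
    exact (pow_left_inj₀ (by positivity) (by positivity) two_ne_zero).mp this
  refine coefficients_eq_zero hm hl8
    (a := fun k => ∑ c ∈ codewordsOfWeight C (4 * m + 4 + 4 * k), pairProduct l c)
    (fun x y => ?_) hk₀ h0 hk
  have h := sum_fourier C (harmonicWeight l x y)
  simp only [fourier_harmonicWeight l hnd, hdual, ← Finset.mul_sum, hcard] at h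
  rw [sum_harmonicWeight_eq hn hm hC hnd hl hl8, sum_harmonicWeight_eq hn hm hC hnd hl hl8] at h
  exact h

theorem isTDesign_of_isTDesign {m n : ℕ} (hn : n = 24 * m)
    {C : Submodule (ZMod 2) (Fin n → ZMod 2)} (hC : IsExtremalTypeII C) {w₀ w : ℕ}
    (hw₀ : IsSupportDesignWeight n w₀) (hw : IsSupportDesignWeight n w)
    (h : IsTDesign 8 (supportDesign C w₀)) : IsTDesign 8 (supportDesign C w) := by
  obtain ⟨hmod₀, hlo₀, hhi₀⟩ := hw₀
  obtain ⟨hmod, hlo, hhi⟩ := hw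
  have hdiv : n / 24 = m := by omega
  rw [hdiv] at hlo₀ hhi₀ hlo hhi
  unfold Nat.ModEq at hmod₀ hmod
  obtain ⟨k₀, hk₀⟩ : ∃ k₀, w₀ = 4 * m + 4 + 4 * k₀ := ⟨w₀ / 4 - (m + 1), by omega⟩
  obtain ⟨k, hk⟩ : ∃ k, w = 4 * m + 4 + 4 * k := ⟨w / 4 - (m + 1), by omega⟩
  subst hk₀ hk
  rw [isTDesign_supportDesign_iff C (by omega) (by omega)] at h ⊢
  intro l hnd hl hl8
  -- The existence of an admissible weight forces `1 ≤ m`.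
  exact sum_pairProduct_eq_zero hn (by omega) hC hnd hl hl8 (by omega) (by omega)
    (h l hnd hl hl8)

end ExtremalCode

theorem mainTheorem5 (m n : ℕ) (hn : n = 24 * m)
    (C : Submodule (ZMod 2) (Fin n → ZMod 2)) (hC : IsExtremalTypeII C) :
    (∀ w : ℕ, IsSupportDesignWeight n w → IsTDesign 8 (supportDesign C w)) ∨
      (∀ w : ℕ, IsSupportDesignWeight n w → ¬ IsTDesign 8 (supportDesign C w)) := by
  by_cases h : ∃ w₀, IsSupportDesignWeight n w₀ ∧ IsTDesign 8 (supportDesign C w₀)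
  · obtain ⟨w₀, hw₀, h₀⟩ := h
    exact Or.inl fun w hw => ExtremalCode.isTDesign_of_isTDesign hn hC hw₀ hw h₀
  · exact Or.inr fun w hw hd => h ⟨w, hw, hd⟩
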